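/- Consider $(0,1)$ with its Borel $\sigma$-field $\mathcal F$ and Lebesgue measure $P$. A sub-$\sigma$-field is a $\sigma$-field $\mathcal E\subset\mathcal F$ that contains all sets in $\mathcal F$ of measure zero. Identify $\mathcal E$ with the closed subspace $L_2(\mathcal E)$ of $L_2=L_2((0,1),\mathcal F,P)$ of (classes of) $\mathcal E$-measurable functions, and equip the set $X$ of all sub-$\sigma$-fields with the Wijsman topology, that is, the coarsest topology for which $\mathcal E\mapsto \operatorname{dist}(f,L_2(\mathcal E))$ is continuous for every $f\in L_2$. A sub-$\sigma$-field $\mathcal E$ is conditionally nonatomic if for almost every $\omega\in(0,1)$ the conditional measure $P(\,\cdot\mid\mathcal E)(\omega)$ (the regular conditional probability) has no atoms. Let $X_1\subset X$ be the set of all conditionally nonatomic sub-$\sigma$-fields. A sub-$\sigma$-field is called finite if it is generated by finitely many sets together with the sets of measure zero. Then $X$ is a Polish space, and $X_1$ is a $G_\delta$ subset of $X$. Moreover, every finite sub-$\sigma$-field belongs to $X_1$, and the finite sub-$\sigma$-fields are dense in $X$. Hence $X_1$ is a dense $G_\delta$ subset of $X$, and therefore comeager in $X$. -/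

import Mathlib

open MeasureTheory ProbabilityTheory

/-- A sub-σ-field of the probability space `(Ω, P)`: a σ-field `sigma` contained in the given
σ-field `mΩ` of `Ω` and containing all sets of `mΩ` of measure zero. -/
structure SubSigmaField (Ω : Type*) [mΩ : MeasurableSpace Ω] (P : Measure Ω) where
  sigma : MeasurableSpace Ω
  le : sigma ≤ mΩ
  null_mem : ∀ s : Set Ω, MeasurableSet[mΩ] s → P s = 0 → MeasurableSet[sigma] s

namespace SubSigmaField

/-- The closed subspace `L₂(E)` of `L₂(Ω, P)`: classes of square integrable random variables that
have an `E`-measurable representative. -/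
noncomputable def l2 {Ω : Type*} [mΩ : MeasurableSpace Ω] {P : Measure Ω}
    (E : SubSigmaField Ω P) : Submodule ℝ (Lp ℝ 2 P) :=
  lpMeas ℝ ℝ E.sigma 2 P

/-- The Wijsman topology on sub-σ-fields, each sub-σ-field `E` being identified with the closed
subspace `L₂(E)` of `L₂(Ω, P)`: the coarsest topology for which `E ↦ dist (f, L₂(E))` is
continuous for every `f ∈ L₂(Ω, P)`. (Since `dist (c f, L) = |c| dist (f, L)` for a linear subspace
`L`, replacing the metric by its truncation at `1` gives the same topology.) -/
noncomputable instance {Ω : Type*} [mΩ : MeasurableSpace Ω] {P : Measure Ω} :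
    TopologicalSpace (SubSigmaField Ω P) :=
  TopologicalSpace.induced
    (fun (E : SubSigmaField Ω P) (f : Lp ℝ 2 P) => Metric.infDist f (E.l2 : Set (Lp ℝ 2 P)))
    inferInstance

/-- `E` is conditionally nonatomic: for almost every `ω`, the conditional measure at `ω` (the
regular conditional probability of `P` given `E`) has no atoms. As `Ω` is standard Borel, an
atom of a probability measure on `Ω` is carried by a single point. -/
def IsCondNonatomic {Ω : Type*} [mΩ : MeasurableSpace Ω] [StandardBorelSpace Ω] {P : Measure Ω}
    [IsFiniteMeasure P] (E : SubSigmaField Ω P) : Prop :=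
  ∀ᵐ ω ∂P, ∀ x : Ω, condExpKernel P E.sigma ω {x} = 0

/-- `E` is a finite sub-σ-field, that is, it is generated by finitely many sets (equivalently, by a
finite measurable partition) together with the sets of measure zero. -/
def IsFinite {Ω : Type*} [mΩ : MeasurableSpace Ω] {P : Measure Ω}
    (E : SubSigmaField Ω P) : Prop :=
  ∃ C : Set (Set Ω), C.Finite ∧
    E.sigma = MeasurableSpace.generateFrom (C ∪ {s | MeasurableSet[mΩ] s ∧ P s = 0})

end SubSigmaField

/-- The interval `(0, 1)`, with its Borel σ-field. -/
abbrev FavSpace : Type := Set.Ioo (0 : ℝ) 1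

/-- Lebesgue measure on `(0, 1)`. -/
noncomputable def favMeasure : Measure FavSpace := Measure.comap Subtype.val volume

instance : IsProbabilityMeasure favMeasure where
  measure_univ := by
    rw [favMeasure, comap_subtype_coe_apply measurableSet_Ioo]
    have h : Subtype.val '' (Set.univ : Set FavSpace) = Set.Ioo (0 : ℝ) 1 := by
      rw [Set.image_univ, Subtype.range_coe]
    rw [h]
    simp

instance : StandardBorelSpace FavSpace := measurableSet_Ioo.standardBorel

/-- The space of all sub-σ-fields of `(0, 1)`. -/
abbrev SSFfav : Type := SubSigmaField FavSpace favMeasure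

/-- The set of all conditionally nonatomic sub-σ-fields of `(0, 1)`. -/
def condNonatomicSet : Set SSFfav := {E | E.IsCondNonatomic}

/-! A sub-σ-field `E` is determined by the orthogonal projection onto `L₂(E)`, which is conditional
expectation. Pythagoras and polarization turn continuity of distances into norm continuity of `E ↦
𝔼[f | E]`. Evaluating the projections on a dense sequence therefore maps the space continuously and
injectively into a countable power of `L₂`. A pointwise limit of such projections is the projection
onto a closed vector sublattice containing the constants, and every such sublattice is some `L₂(E)`
(`l2_ofSublattice`). Hence the map is a closed embedding and the space is Polish.

Conditional nonatomicity is tested by `cellEnergy n`: cut `(0, 1)` into `n + 1` equal cells `A` and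
sum `‖P(A | E)‖²`. This is continuous in `E`, and it is the mean of `∑ ν(A)²` over the conditional
measures `ν`. The sum is at least `ν {x} ^ 2` for each point `x`, and tends to `0` when `ν` is
diffuse. So `E` is conditionally nonatomic iff its energies come arbitrarily close to `0`, a Gδ
condition.

For finite `E` the space `L₂(E)` has finite dimension `d`. The normalized cell indicators are
orthonormal, so Bessel bounds the energy by `d / (n + 1)`. Density holds because `L₂(E)` is the
closure of the directed union of the `L₂(G)` with `G` generated by finitely many events of `E`. -/

open Filter Topology
open scoped ENNReal

/-! ### Bounded convergence and indicators in `L₂` -/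

/-- Bounded convergence in `L₂` of a finite measure. -/
theorem tendsto_lp_two_of_bounded {Ω : Type*} [MeasurableSpace Ω] {P : Measure Ω}
    [IsFiniteMeasure P] (F : ℕ → Lp ℝ 2 P) (f : Lp ℝ 2 P) (C : ℝ)
    (hF : ∀ n, ∀ᵐ ω ∂P, |F n ω| ≤ C)
    (h : ∀ᵐ ω ∂P, Tendsto (fun n => F n ω) atTop (𝓝 (f ω))) :
    Tendsto F atTop (𝓝 f) := by
  have hint : Tendsto (fun n => ∫ ω, (F n ω - f ω) ^ 2 ∂P) atTop (𝓝 0) := by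
    have h0 : (0 : ℝ) = ∫ ω, (0 : ℝ) ∂P := by simp
    rw [h0]
    refine tendsto_integral_of_dominated_convergence (fun _ => (C + C) ^ 2) ?_
      (integrable_const _) ?_ ?_
    · intro n
      exact ((Lp.aestronglyMeasurable (F n)).sub (Lp.aestronglyMeasurable f)).pow 2
    · intro n
      filter_upwards [hF n, ae_all_iff.2 hF, h] with ω h1 h2 h3
      have h4 : |f ω| ≤ C := le_of_tendsto' h3.abs h2
      rw [Real.norm_eq_abs, abs_of_nonneg (sq_nonneg _), ← sq_abs]
      exact pow_le_pow_left₀ (abs_nonneg _) ((abs_sub _ _).trans (add_le_add h1 h4)) 2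
    · filter_upwards [h] with ω hω
      have := (hω.sub_const (f ω)).pow 2
      simpa using this
  have hnorm : ∀ n, ∫ ω, (F n ω - f ω) ^ 2 ∂P = ‖F n - f‖ ^ 2 := by
    intro n
    rw [← real_inner_self_eq_norm_sq, L2.inner_def]
    refine integral_congr_ae ?_
    filter_upwards [Lp.coeFn_sub (F n) f] with ω hω
    simp only [hω, Pi.sub_apply, sq, RCLike.inner_apply, conj_trivial]
  simp_rw [hnorm] at hint
  rw [tendsto_iff_norm_sub_tendsto_zero]
  have := hint.sqrt
  simpa using this

/-- The class in `L₂` of the indicator function of a measurable set. -/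
noncomputable def indicatorL2 {Ω : Type*} [MeasurableSpace Ω] (P : Measure Ω)
    [IsFiniteMeasure P] {A : Set Ω} (hA : MeasurableSet A) : Lp ℝ 2 P :=
  indicatorConstLp 2 hA (measure_ne_top P A) 1

theorem coeFn_indicatorL2 {Ω : Type*} [MeasurableSpace Ω] {P : Measure Ω}
    [IsFiniteMeasure P] {A : Set Ω} (hA : MeasurableSet A) :
    indicatorL2 P hA =ᵐ[P] A.indicator fun _ => (1 : ℝ) :=
  indicatorConstLp_coeFn

theorem indicatorL2_congr {Ω : Type*} [MeasurableSpace Ω] {P : Measure Ω}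
    [IsFiniteMeasure P] {A B : Set Ω} (hA : MeasurableSet A) (hB : MeasurableSet B)
    (h : A =ᵐ[P] B) : indicatorL2 P hA = indicatorL2 P hB :=
  Lp.ext <| (coeFn_indicatorL2 hA).trans <|
    (indicator_ae_eq_of_ae_eq_set h).trans (coeFn_indicatorL2 hB).symm

/-! ### The subspace `L₂(E)` and the events of `E` -/

namespace SubSigmaField

variable {Ω : Type*} [mΩ : MeasurableSpace Ω] {P : Measure Ω}

theorem mem_l2 {E : SubSigmaField Ω P} {f : Lp ℝ 2 P} :
    f ∈ E.l2 ↔ AEStronglyMeasurable[E.sigma] f P :=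
  mem_lpMeas_iff_aestronglyMeasurable

instance (E : SubSigmaField Ω P) : CompleteSpace E.l2 := by
  have : Fact (E.sigma ≤ mΩ) := ⟨E.le⟩
  exact inferInstanceAs (CompleteSpace (lpMeas ℝ ℝ E.sigma 2 P))

theorem measurableSet_of_ae_eq (E : SubSigmaField Ω P) {A B : Set Ω} (hA : MeasurableSet A)
    (hB : MeasurableSet[E.sigma] B) (h : A =ᵐ[P] B) : MeasurableSet[E.sigma] A := by
  have h1 : MeasurableSet[E.sigma] (A \ B) :=
    E.null_mem _ (hA.diff (E.le _ hB)) (ae_le_set.1 h.le)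
  have h2 : MeasurableSet[E.sigma] (B \ A) :=
    E.null_mem _ ((E.le _ hB).diff hA) (ae_le_set.1 h.symm.le)
  have : A = (B \ (B \ A)) ∪ (A \ B) := by ext; simp; tauto
  rw [this]
  exact (hB.diff h2).union h1

/-- The level set at `1` of an `E`-measurable representative differs from `A` by a null set, and `E`
contains the null sets. Thus `E` can be read off from `L₂(E)`. -/
theorem indicatorL2_mem_l2 [IsFiniteMeasure P] {E : SubSigmaField Ω P} {A : Set Ω}
    (hA : MeasurableSet A) : indicatorL2 P hA ∈ E.l2 ↔ MeasurableSet[E.sigma] A := by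
  rw [mem_l2]
  constructor
  · rintro ⟨g, hg, hfg⟩
    refine E.measurableSet_of_ae_eq hA
      (hg.measurable (measurableSet_singleton (1 : ℝ))) ?_
    filter_upwards [hfg, coeFn_indicatorL2 (P := P) hA] with ω h1 h2
    rw [h2] at h1
    refine propext ?_
    change ω ∈ A ↔ g ω = 1
    rw [← h1]
    by_cases h : ω ∈ A <;> simp [h]
  · intro h
    exact ⟨_, (@stronglyMeasurable_const _ _ E.sigma _ 1).indicator h, coeFn_indicatorL2 hA⟩

/-- A closed subspace containing the indicators of the sets of `E` contains `L₂(E)`. -/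
theorem l2_le_of_indicator [IsFiniteMeasure P] {E : SubSigmaField Ω P}
    {W : Submodule ℝ (Lp ℝ 2 P)} (hW : IsClosed (W : Set (Lp ℝ 2 P)))
    (h : ∀ A (hA : MeasurableSet[E.sigma] A), indicatorL2 P (E.le A hA) ∈ W) : E.l2 ≤ W := by
  intro f hf
  refine Lp.induction_stronglyMeasurable E.le (by simp) (fun f => f ∈ W) ?_ ?_ ?_ f (mem_l2.1 hf)
  · intro c s hs hμ
    rw [Lp.simpleFunc.coe_indicatorConst]
    have : indicatorConstLp 2 (E.le s hs) hμ.ne c = c • indicatorL2 P (E.le s hs) := by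
      refine Lp.ext ?_
      filter_upwards [Lp.coeFn_smul c (indicatorL2 P (E.le s hs)),
        coeFn_indicatorL2 (P := P) (E.le s hs),
        indicatorConstLp_coeFn (p := 2) (hs := E.le s hs) (hμs := hμ.ne) (c := c)] with ω h1 h2 h3
      rw [h1, h3, Pi.smul_apply, h2]
      by_cases hω : ω ∈ s <;> simp [hω]
    rw [this]
    exact W.smul_mem _ (h s hs)
  · intro f g hf hg _ _ _ h1 h2
    exact W.add_mem h1 h2
  · exact hW.preimage continuous_subtype_val

theorem ext_of_l2 [IsFiniteMeasure P] {E F : SubSigmaField Ω P} (h : E.l2 = F.l2) : E = F := by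
  have : E.sigma = F.sigma := by
    ext A
    constructor
    · intro hA
      rwa [← indicatorL2_mem_l2 (E.le A hA), ← h, indicatorL2_mem_l2 (E.le A hA)]
    · intro hA
      rwa [← indicatorL2_mem_l2 (F.le A hA), h, indicatorL2_mem_l2 (F.le A hA)]
  cases E; cases F; cases this; rfl

end SubSigmaField

/-! ### Closed vector sublattices of `L₂` containing the constants -/

section Lattice

variable {Ω : Type*} [mΩ : MeasurableSpace Ω] {P : Measure Ω} {W : Submodule ℝ (Lp ℝ 2 P)}

theorem Submodule.sup_mem_of_abs (habs : ∀ f ∈ W, |f| ∈ W) {f g : Lp ℝ 2 P} (hf : f ∈ W)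
    (hg : g ∈ W) : f ⊔ g ∈ W := by
  rw [sup_eq_half_smul_add_add_abs_sub' ℝ]
  exact W.smul_mem _ (W.add_mem (W.add_mem hf hg) (habs _ (W.sub_mem hg hf)))

theorem Submodule.inf_mem_of_abs (habs : ∀ f ∈ W, |f| ∈ W) {f g : Lp ℝ 2 P} (hf : f ∈ W)
    (hg : g ∈ W) : f ⊓ g ∈ W := by
  rw [inf_eq_half_smul_add_sub_abs_sub' ℝ]
  exact W.smul_mem _ (W.sub_mem (W.add_mem hf hg) (habs _ (W.sub_mem hg hf)))

variable [IsFiniteMeasure P]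

theorem indicatorL2_compl {A : Set Ω} (hA : MeasurableSet A) :
    indicatorL2 P hA.compl = indicatorL2 P MeasurableSet.univ - indicatorL2 P hA := by
  refine Lp.ext ?_
  filter_upwards [Lp.coeFn_sub (indicatorL2 P MeasurableSet.univ) (indicatorL2 P hA),
    coeFn_indicatorL2 (P := P) hA, coeFn_indicatorL2 (P := P) hA.compl,
    coeFn_indicatorL2 (P := P) MeasurableSet.univ] with ω h1 h2 h3 h4
  rw [h1, Pi.sub_apply, h2, h3, h4]
  by_cases h : ω ∈ A <;> simp [h]

theorem indicatorL2_union {A B : Set Ω} (hA : MeasurableSet A) (hB : MeasurableSet B) :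
    indicatorL2 P (hA.union hB) = indicatorL2 P hA ⊔ indicatorL2 P hB := by
  refine Lp.ext ?_
  filter_upwards [Lp.coeFn_sup (indicatorL2 P hA) (indicatorL2 P hB),
    coeFn_indicatorL2 (P := P) hA, coeFn_indicatorL2 (P := P) hB,
    coeFn_indicatorL2 (P := P) (hA.union hB)] with ω h1 h2 h3 h4
  rw [h1, Pi.sup_apply, h2, h3, h4]
  by_cases h : ω ∈ A <;> by_cases h' : ω ∈ B <;> simp [h, h']

/-- Finite unions are suprema, and the indicators of the partial unions converge boundedly to that
of the whole union. -/
theorem indicatorL2_iUnion_mem (hW : IsClosed (W : Set (Lp ℝ 2 P)))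
    (habs : ∀ f ∈ W, |f| ∈ W) {A : ℕ → Set Ω} (hA : ∀ n, MeasurableSet (A n))
    (h : ∀ n, indicatorL2 P (hA n) ∈ W) : indicatorL2 P (MeasurableSet.iUnion hA) ∈ W := by
  have hm : ∀ n, MeasurableSet (Set.accumulate A n) := fun n =>
    MeasurableSet.biUnion (Set.to_countable _) fun i _ => hA i
  have hmem : ∀ n, indicatorL2 P (hm n) ∈ W := by
    intro n
    induction n with
    | zero => simpa [Set.accumulate_zero_nat] using h 0
    | succ n ih =>
      have := Submodule.sup_mem_of_abs habs ih (h (n + 1))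
      rw [← indicatorL2_union] at this
      simpa [Set.accumulate_succ] using this
  refine hW.mem_of_tendsto (b := atTop) (f := fun n => indicatorL2 P (hm n))
    (tendsto_lp_two_of_bounded _ _ 1 ?_ ?_) (Eventually.of_forall hmem)
  · intro n
    filter_upwards [coeFn_indicatorL2 (P := P) (hm n)] with ω hω
    rw [hω]
    by_cases h : ω ∈ Set.accumulate A n <;> simp [h]
  · filter_upwards [ae_all_iff.2 fun n => coeFn_indicatorL2 (P := P) (hm n),
      coeFn_indicatorL2 (P := P) (MeasurableSet.iUnion hA)] with ω h1 h2
    simp only [h1, h2]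
    rw [← Set.iUnion_accumulate]
    exact (Set.monotone_accumulate.tendsto_indicator _ _ _).mono_right (pure_le_nhds _)

/-- The indicator of `{f > c}` is the bounded pointwise limit of the lattice expressions `min 1 (n *
(f - c)⁺)`. -/
theorem indicatorL2_lt_mem (hW : IsClosed (W : Set (Lp ℝ 2 P)))
    (habs : ∀ f ∈ W, |f| ∈ W) (h1 : indicatorL2 P MeasurableSet.univ ∈ W) {f : Lp ℝ 2 P}
    (hf : f ∈ W) (c : ℝ) (hA : MeasurableSet {ω | c < f ω}) : indicatorL2 P hA ∈ W := by
  set u := indicatorL2 P (A := Set.univ) MeasurableSet.univ with hu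
  set g : Lp ℝ 2 P := (f - c • u) ⊔ 0 with hg
  have hgW : g ∈ W :=
    Submodule.sup_mem_of_abs habs (W.sub_mem hf (W.smul_mem _ h1)) W.zero_mem
  have hg' : ∀ᵐ ω ∂P, g ω = max (f ω - c) 0 := by
    filter_upwards [Lp.coeFn_sup (f - c • u) 0, Lp.coeFn_sub f (c • u), Lp.coeFn_smul c u,
      coeFn_indicatorL2 (P := P) MeasurableSet.univ, Lp.coeFn_zero ℝ 2 P] with ω h1 h2 h3 h4 h5
    rw [hg, h1, Pi.sup_apply, h2, Pi.sub_apply, h3, Pi.smul_apply, h4, h5]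
    simp
  have hF : ∀ n : ℕ, ∀ᵐ ω ∂P, (u ⊓ ((n : ℝ) • g) : Lp ℝ 2 P) ω = min 1 (n * max (f ω - c) 0) := by
    intro n
    filter_upwards [Lp.coeFn_inf u ((n : ℝ) • g), Lp.coeFn_smul (n : ℝ) g, hg',
      coeFn_indicatorL2 (P := P) MeasurableSet.univ] with ω h1 h2 h3 h4
    rw [h1, Pi.inf_apply, h2, Pi.smul_apply, h3, hu, h4]
    simp
  refine hW.mem_of_tendsto (b := atTop) (f := fun n : ℕ => u ⊓ ((n : ℝ) • g))
    (tendsto_lp_two_of_bounded _ _ 1 ?_ ?_)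
    (Eventually.of_forall fun n => Submodule.inf_mem_of_abs habs h1 (W.smul_mem _ hgW))
  · intro n
    filter_upwards [hF n] with ω hω
    rw [hω, abs_of_nonneg (by positivity)]
    exact min_le_left _ _
  · filter_upwards [ae_all_iff.2 hF, coeFn_indicatorL2 (P := P) hA] with ω h1 h2
    simp only [h1, h2]
    by_cases h : c < f ω
    · rw [Set.indicator_of_mem (by exact h)]
      have hpos : 0 < f ω - c := sub_pos.2 h
      obtain ⟨N, hN⟩ := exists_nat_ge (f ω - c)⁻¹
      refine tendsto_const_nhds.congr' ?_
      filter_upwards [eventually_ge_atTop N] with n hn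
      rw [max_eq_left hpos.le, min_eq_left]
      have : (f ω - c)⁻¹ ≤ n := hN.trans (by exact_mod_cast hn)
      rwa [inv_le_iff_one_le_mul₀ hpos] at this
    · rw [Set.indicator_of_notMem (by exact h)]
      have : max (f ω - c) 0 = 0 := max_eq_right (by linarith)
      simp [this]

/-- The sub-σ-field of the events whose indicators belong to a closed vector sublattice of `L₂`
containing the constants. -/
def SubSigmaField.ofSublattice (hW : IsClosed (W : Set (Lp ℝ 2 P)))
    (habs : ∀ f ∈ W, |f| ∈ W) (h1 : indicatorL2 P MeasurableSet.univ ∈ W) :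
    SubSigmaField Ω P where
  sigma :=
    { MeasurableSet' := fun A => ∃ hA : MeasurableSet A, indicatorL2 P hA ∈ W
      measurableSet_empty := ⟨MeasurableSet.empty, by simp [indicatorL2]⟩
      measurableSet_compl := fun A h =>
        ⟨h.1.compl, by rw [indicatorL2_compl h.1]; exact W.sub_mem h1 h.2⟩
      measurableSet_iUnion := fun A h => ⟨MeasurableSet.iUnion fun n => (h n).1,
        indicatorL2_iUnion_mem hW habs (fun n => (h n).1) fun n => (h n).2⟩ }
  le := fun _ hA => hA.1
  null_mem := fun A hA h0 => ⟨hA, by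
    rw [indicatorL2_congr hA MeasurableSet.empty (ae_eq_empty.2 h0)]; simp [indicatorL2]⟩

/-- One inclusion is approximation by simple functions; for the other, the superlevel sets of any `f
∈ W` are events of the σ-field, so `f` is measurable for it. -/
theorem SubSigmaField.l2_ofSublattice (hW : IsClosed (W : Set (Lp ℝ 2 P)))
    (habs : ∀ f ∈ W, |f| ∈ W) (h1 : indicatorL2 P MeasurableSet.univ ∈ W) :
    (SubSigmaField.ofSublattice hW habs h1).l2 = W := by
  refine le_antisymm (l2_le_of_indicator hW fun A hA => hA.2) fun f hf => ?_
  rw [mem_l2]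
  refine @Measurable.aestronglyMeasurable _ _ _ (SubSigmaField.ofSublattice hW habs h1).sigma
    _ _ _ _ _ _ _ (measurable_of_Ioi fun c => ?_)
  have hA : MeasurableSet {ω | c < f ω} :=
    measurableSet_lt measurable_const (Lp.stronglyMeasurable f).measurable
  exact ⟨hA, indicatorL2_lt_mem hW habs h1 hf c hA⟩

end Lattice

/-! ### Convergence of conditional expectations and Polishness -/

namespace SubSigmaField

variable {Ω : Type*} [mΩ : MeasurableSpace Ω] {P : Measure Ω}

theorem infDist_l2 (E : SubSigmaField Ω P) (f : Lp ℝ 2 P) :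
    Metric.infDist f (E.l2 : Set (Lp ℝ 2 P)) = ‖f - E.l2.starProjection f‖ := by
  rw [Metric.infDist_eq_iInf, Submodule.starProjection_minimal]
  simp_rw [dist_eq_norm]
  rfl

theorem tendsto_nhds_iff {ι : Type*} {F : Filter ι} {u : ι → SubSigmaField Ω P}
    {E : SubSigmaField Ω P} :
    Tendsto u F (𝓝 E) ↔ ∀ f : Lp ℝ 2 P, Tendsto (fun i => Metric.infDist f ((u i).l2 : Set _)) F
      (𝓝 (Metric.infDist f (E.l2 : Set _))) := by
  rw [nhds_induced, tendsto_comap_iff, tendsto_pi_nhds]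
  rfl

theorem continuous_infDist (f : Lp ℝ 2 P) :
    Continuous fun E : SubSigmaField Ω P => Metric.infDist f (E.l2 : Set (Lp ℝ 2 P)) :=
  continuous_iff_continuousAt.2 fun _ => tendsto_nhds_iff.1 tendsto_id f

theorem norm_sq_starProjection (E : SubSigmaField Ω P) (f : Lp ℝ 2 P) :
    ‖E.l2.starProjection f‖ ^ 2 = ‖f‖ ^ 2 - Metric.infDist f (E.l2 : Set (Lp ℝ 2 P)) ^ 2 := by
  have h : inner ℝ (E.l2.starProjection f) (f - E.l2.starProjection f) = 0 :=
    (Submodule.mem_orthogonal _ _).1 (Submodule.sub_starProjection_mem_orthogonal f) _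
      (Submodule.starProjection_apply_mem _ f)
  have := norm_add_sq_real (E.l2.starProjection f) (f - E.l2.starProjection f)
  rw [h, add_sub_cancel] at this
  rw [infDist_l2, this]
  ring

theorem continuous_norm_sq_starProjection (f : Lp ℝ 2 P) :
    Continuous fun E : SubSigmaField Ω P => ‖E.l2.starProjection f‖ ^ 2 := by
  simp_rw [norm_sq_starProjection]
  exact continuous_const.sub ((continuous_infDist f).pow 2)

/-- Polarization: the matrix coefficients of the projection depend only on norms of projected
vectors, hence continuously on `E`. -/
theorem inner_starProjection_eq (E : SubSigmaField Ω P) (f g : Lp ℝ 2 P) :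
    inner ℝ (E.l2.starProjection f) g =
      (‖E.l2.starProjection (f + g)‖ ^ 2 - ‖E.l2.starProjection (f - g)‖ ^ 2) / 4 := by
  have h : inner ℝ (E.l2.starProjection f) g =
      inner ℝ (E.l2.starProjection f) (E.l2.starProjection g) := by
    rw [← sub_eq_zero, ← inner_sub_right]
    exact (Submodule.mem_orthogonal _ _).1 (Submodule.sub_starProjection_mem_orthogonal g) _
      (Submodule.starProjection_apply_mem _ f)
  rw [h, map_add, map_sub, norm_add_sq_real, norm_sub_sq_real]
  ring

/-- The Wijsman topology makes `E ↦ 𝔼[f | E]` norm continuous. -/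
theorem continuous_starProjection (f : Lp ℝ 2 P) :
    Continuous fun E : SubSigmaField Ω P => E.l2.starProjection f := by
  refine continuous_iff_continuousAt.2 fun E₀ => ?_
  rw [ContinuousAt, tendsto_iff_norm_sub_tendsto_zero]
  -- Weak convergence together with convergence of norms gives norm convergence: the expanded square
  -- is continuous in `E` and vanishes at `E₀`.
  have h : Continuous fun E : SubSigmaField Ω P =>
      ‖E.l2.starProjection f - E₀.l2.starProjection f‖ ^ 2 := by
    simp_rw [norm_sub_sq_real, inner_starProjection_eq _ f (E₀.l2.starProjection f)]
    have h1 := continuous_norm_sq_starProjection (P := P) f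
    have h2 := continuous_norm_sq_starProjection (P := P) (f + E₀.l2.starProjection f)
    have h3 := continuous_norm_sq_starProjection (P := P) (f - E₀.l2.starProjection f)
    fun_prop
  have := (h.tendsto E₀).sqrt
  simpa using this

theorem tendsto_nhds_of_tendsto_starProjection {F : Filter (SubSigmaField Ω P)}
    {E₀ : SubSigmaField Ω P}
    (h : ∀ f, Tendsto (fun E : SubSigmaField Ω P => E.l2.starProjection f) F
      (𝓝 (E₀.l2.starProjection f))) : F ≤ 𝓝 E₀ := by
  refine tendsto_id'.1 (tendsto_nhds_iff.2 fun f => ?_)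
  simp_rw [infDist_l2]
  exact ((h f).const_sub f).norm

theorem dist_starProjection_le (E : SubSigmaField Ω P) (f g : Lp ℝ 2 P) :
    dist (E.l2.starProjection f) (E.l2.starProjection g) ≤ dist f g := by
  rw [dist_eq_norm, dist_eq_norm, ← map_sub]
  exact Submodule.norm_starProjection_apply_le _ _

theorem abs_mem_l2 (E : SubSigmaField Ω P) {f : Lp ℝ 2 P} (hf : f ∈ E.l2) : |f| ∈ E.l2 := by
  rw [mem_l2] at hf ⊢
  obtain ⟨g, hg, hfg⟩ := hf
  refine ⟨fun ω => |g ω|, hg.norm, ?_⟩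
  filter_upwards [Lp.coeFn_abs f, hfg] with ω h1 h2
  rw [h1, h2]

/-- A pointwise limit of conditional expectation operators along a filter is again a conditional
expectation operator; it is enough to have convergence on a dense set. -/
theorem exists_tendsto_starProjection [IsFiniteMeasure P] {F : Filter (SubSigmaField Ω P)}
    [F.NeBot] {d T : ℕ → Lp ℝ 2 P} (hd : DenseRange d)
    (h : ∀ n, Tendsto (fun E : SubSigmaField Ω P => E.l2.starProjection (d n)) F (𝓝 (T n))) :
    ∃ E₀ : SubSigmaField Ω P, ∀ f,
      Tendsto (fun E : SubSigmaField Ω P => E.l2.starProjection f) F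
        (𝓝 (E₀.l2.starProjection f)) := by
  have hlim : ∀ f, ∃ g, Tendsto (fun E : SubSigmaField Ω P => E.l2.starProjection f) F (𝓝 g) := by
    intro f
    refine CompleteSpace.complete (Metric.cauchy_iff.2 ⟨inferInstance, fun ε hε => ?_⟩)
    obtain ⟨n, hn⟩ := hd.exists_dist_lt f (by positivity : 0 < ε / 4)
    refine ⟨Metric.ball (T n) (ε / 2), ?_, fun x hx y hy => ?_⟩
    · rw [mem_map]
      filter_upwards [(h n).eventually (Metric.ball_mem_nhds (T n) (by positivity : 0 < ε / 4))]
        with E hE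
      have hE : dist _ _ < _ := hE
      change dist _ _ < _
      linarith [dist_triangle (E.l2.starProjection f) (E.l2.starProjection (d n)) (T n),
        E.dist_starProjection_le f (d n)]
    · rw [Metric.mem_ball] at hx hy
      linarith [dist_triangle_right x y (T n)]
  choose S hS using hlim
  have hadd : ∀ f g, S (f + g) = S f + S g := fun f g => by
    refine tendsto_nhds_unique (hS (f + g)) ?_
    simpa only [map_add] using (hS f).add (hS g)
  have hsmul : ∀ (c : ℝ) f, S (c • f) = c • S f := fun c f => by
    refine tendsto_nhds_unique (hS (c • f)) ?_
    simpa only [map_smul] using (hS f).const_smul c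
  have hdist : ∀ f g, dist (S f) (S g) ≤ dist f g := fun f g =>
    le_of_tendsto' ((hS f).dist (hS g)) fun E => E.dist_starProjection_le f g
  have hcont : Continuous S := (LipschitzWith.mk_one hdist).continuous
  have hidem : ∀ f, S (S f) = S f := fun f => by
    refine tendsto_nhds_unique (hS (S f)) ?_
    rw [tendsto_iff_dist_tendsto_zero]
    -- Since `E.l2.starProjection f` is fixed by the contraction `E.l2.starProjection` and tends to
    -- `S f`, the image of `S f` tends to `S f` as well.
    have h0 := ((hS f).const_sub (S f)).norm.add (tendsto_iff_norm_sub_tendsto_zero.1 (hS f))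
    rw [sub_self, norm_zero, add_zero] at h0
    refine squeeze_zero (fun _ => dist_nonneg) (fun E => ?_) h0
    refine (dist_triangle _ (E.l2.starProjection f) _).trans ?_
    rw [← dist_eq_norm, ← dist_eq_norm]
    refine add_le_add ?_ le_rfl
    have := E.dist_starProjection_le (S f) (E.l2.starProjection f)
    rwa [Submodule.starProjection_eq_self_iff.2 (Submodule.starProjection_apply_mem _ f)] at this
  let W : Submodule ℝ (Lp ℝ 2 P) :=
    { carrier := {f | S f = f}
      add_mem' := fun {f g} hf hg => by
        change S (f + g) = f + g
        rw [hadd, show S f = f from hf, show S g = g from hg]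
      zero_mem' := by
        change S 0 = 0
        simpa using hsmul 0 0
      smul_mem' := fun c f hf => by
        change S (c • f) = c • f
        rw [hsmul, show S f = f from hf] }
  have hW : IsClosed (W : Set (Lp ℝ 2 P)) := isClosed_eq hcont continuous_id
  have h1 : indicatorL2 P MeasurableSet.univ ∈ W := by
    change S _ = _
    refine tendsto_nhds_unique (hS _) (tendsto_const_nhds.congr fun E => ?_)
    exact (Submodule.starProjection_eq_self_iff.2
      ((indicatorL2_mem_l2 MeasurableSet.univ).2 MeasurableSet.univ)).symm
  have habs : ∀ f ∈ W, |f| ∈ W := by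
    intro f hf
    have hf' := hS f
    rw [show S f = f from hf] at hf'
    change S |f| = |f|
    refine tendsto_nhds_unique (hS |f|) ?_
    rw [tendsto_iff_dist_tendsto_zero]
    have h0 := tendsto_iff_norm_sub_tendsto_zero.1 hf'
    refine squeeze_zero (fun _ => dist_nonneg) (fun E => ?_) h0
    rw [dist_comm, dist_eq_norm, ← infDist_l2, norm_sub_rev]
    -- The element `|𝔼[f | E]|` of `L₂(E)` is a competitor for the distance from `|f|`, and taking
    -- absolute values does not increase distances.
    refine (Metric.infDist_le_dist_of_mem
      (E.abs_mem_l2 (Submodule.starProjection_apply_mem _ f))).trans ?_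
    rw [dist_eq_norm]
    exact norm_abs_sub_abs _ _
  refine ⟨ofSublattice hW habs h1, fun f => ?_⟩
  suffices (ofSublattice hW habs h1).l2.starProjection f = S f by rw [this]; exact hS f
  refine Submodule.eq_starProjection_of_mem_of_inner_eq_zero ?_ fun g hg => ?_
  · rw [l2_ofSublattice]
    exact hidem f
  · rw [l2_ofSublattice] at hg
    have hg' := hS g
    rw [show S g = g from hg] at hg'
    -- Orthogonality of `f - 𝔼[f | E]` to `𝔼[g | E]` passes to the limit.
    have ht := ((hS f).const_sub f).inner hg' (𝕜 := ℝ)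
    refine tendsto_nhds_unique ht (tendsto_const_nhds.congr fun E => ?_)
    exact ((Submodule.mem_orthogonal' _ _).1 (Submodule.sub_starProjection_mem_orthogonal f) _
      (Submodule.starProjection_apply_mem _ g)).symm

theorem ext_of_starProjection [IsFiniteMeasure P] {E F : SubSigmaField Ω P}
    (h : ∀ f, E.l2.starProjection f = F.l2.starProjection f) : E = F := by
  refine ext_of_l2 (Submodule.ext fun f => ?_)
  rw [← Submodule.starProjection_eq_self_iff, h, Submodule.starProjection_eq_self_iff]

instance polishSpace [IsFiniteMeasure P] [SecondCountableTopology (Lp ℝ 2 P)] :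
    PolishSpace (SubSigmaField Ω P) := by
  set d := TopologicalSpace.denseSeq (Lp ℝ 2 P)
  have hd : DenseRange d := TopologicalSpace.denseRange_denseSeq _
  let Φ : SubSigmaField Ω P → ℕ → Lp ℝ 2 P := fun E n => E.l2.starProjection (d n)
  have hΦ : Continuous Φ := continuous_pi fun n => continuous_starProjection (d n)
  have hinj : Function.Injective Φ := fun E F h => ext_of_starProjection fun f =>
    congrFun (hd.equalizer E.l2.starProjection.continuous F.l2.starProjection.continuous h) f
  -- This single claim serves twice: with `T` in the image it shows that the topology is induced by
  -- `Φ`, and with `T` in the closure of the image that the image is closed.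
  have key : ∀ T : ℕ → Lp ℝ 2 P, (comap Φ (𝓝 T)).NeBot →
      ∃ E, Φ E = T ∧ comap Φ (𝓝 T) ≤ 𝓝 E := by
    intro T hT
    have h := tendsto_pi_nhds.1 (tendsto_comap (f := Φ) (x := 𝓝 T))
    obtain ⟨E, hE⟩ := exists_tendsto_starProjection hd h
    exact ⟨E, funext fun n => tendsto_nhds_unique (hE (d n)) (h n),
      tendsto_nhds_of_tendsto_starProjection hE⟩
  have hind : IsInducing Φ := isInducing_iff_nhds.2 fun E => by
    refine le_antisymm (hΦ.tendsto E).le_comap ?_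
    obtain ⟨E', hE', hle⟩ := key (Φ E) (NeBot.mono inferInstance (hΦ.tendsto E).le_comap)
    rwa [hinj hE'] at hle
  have hcl : IsClosed (Set.range Φ) := by
    refine isClosed_of_closure_subset fun T hT => ?_
    obtain ⟨E, hE, -⟩ := key T (comap_neBot fun t ht => by
      obtain ⟨_, h, E, rfl⟩ := mem_closure_iff_nhds.1 hT t ht
      exact ⟨E, h⟩)
    exact ⟨E, hE⟩
  exact (IsClosedEmbedding.mk ⟨hind, hinj⟩ hcl).polishSpace

end SubSigmaField

/-! ### Finite sub-σ-fields, and projections of indicators as conditional probabilities -/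

namespace SubSigmaField

variable {Ω : Type*} [mΩ : MeasurableSpace Ω] {P : Measure Ω}

theorem l2_mono {E F : SubSigmaField Ω P} (h : E.sigma ≤ F.sigma) : E.l2 ≤ F.l2 := fun _ hf =>
  mem_l2.2 ((mem_l2.1 hf).mono h)

/-- The sub-σ-field generated by a family of events and the null events. -/
def generate (P : Measure Ω) (C : Set (Set Ω)) (hC : ∀ A ∈ C, MeasurableSet A) :
    SubSigmaField Ω P where
  sigma := MeasurableSpace.generateFrom (C ∪ {s | MeasurableSet[mΩ] s ∧ P s = 0})
  le := MeasurableSpace.generateFrom_le fun A hA => hA.elim (hC A) fun h => h.1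
  null_mem _ hs h0 := MeasurableSpace.measurableSet_generateFrom (Or.inr ⟨hs, h0⟩)

theorem generate_le {E : SubSigmaField Ω P} {C : Set (Set Ω)} (hC : ∀ A ∈ C, MeasurableSet A)
    (h : ∀ A ∈ C, MeasurableSet[E.sigma] A) : (generate P C hC).sigma ≤ E.sigma :=
  MeasurableSpace.generateFrom_le fun A hA => hA.elim (h A) fun h => E.null_mem A h.1 h.2

/-- The finite sets of events of `E` are directed by inclusion, and the finite sub-σ-fields they
generate converge to `E`, since the union of their `L₂` spaces is dense in `L₂(E)`. -/
theorem dense_isFinite [IsFiniteMeasure P] : Dense {E : SubSigmaField Ω P | E.IsFinite} := by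
  intro E
  let G : Finset {A : Set Ω // MeasurableSet[E.sigma] A} → SubSigmaField Ω P := fun C =>
    generate P ((↑) '' (C : Set {A : Set Ω // MeasurableSet[E.sigma] A})) (by
      rintro _ ⟨A, -, rfl⟩
      exact E.le _ A.2)
  have hGE : ∀ C, (G C).sigma ≤ E.sigma := fun C => generate_le _ (by
      rintro _ ⟨A, -, rfl⟩
      exact A.2)
  have hmono : Monotone fun C => (G C).l2 := fun C D h => l2_mono <|
    MeasurableSpace.generateFrom_mono <| Set.union_subset_union_left _ <|
      Set.image_mono (by exact_mod_cast h)
  refine mem_closure_of_tendsto (b := atTop) (f := G) (tendsto_nhds_iff.2 fun f => ?_)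
    (Eventually.of_forall fun C => ⟨_, C.finite_toSet.image _, rfl⟩)
  have hle : E.l2 ≤ (⨆ C, (G C).l2).topologicalClosure := by
    refine l2_le_of_indicator (Submodule.isClosed_topologicalClosure _) fun A hA => ?_
    refine Submodule.le_topologicalClosure _ (Submodule.mem_iSup_of_mem {⟨A, hA⟩} ?_)
    exact (indicatorL2_mem_l2 _).2
      (MeasurableSpace.measurableSet_generateFrom (Or.inl ⟨⟨A, hA⟩, by simp, rfl⟩))
  rw [Metric.tendsto_atTop]
  intro ε hε
  -- An `s` in the union within `ε` of the projection of `f` traps the distances: `dist(f, L₂(E)) ≤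
  -- dist(f, L₂(G C)) ≤ dist f s < dist(f, L₂(E)) + ε` for every `C ≥ C₀`.
  obtain ⟨s, hs, hps⟩ := Metric.mem_closure_iff.1
    (hle (Submodule.starProjection_apply_mem E.l2 f)) ε hε
  obtain ⟨C₀, hC₀⟩ := (Submodule.mem_iSup_of_directed _ hmono.directed_le).1 hs
  refine ⟨C₀, fun C hC => ?_⟩
  have h1 : Metric.infDist f (E.l2 : Set (Lp ℝ 2 P)) ≤ Metric.infDist f ((G C).l2 : Set _) :=
    Metric.infDist_le_infDist_of_subset (l2_mono (hGE C)) ⟨0, zero_mem _⟩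
  have h2 : Metric.infDist f ((G C).l2 : Set (Lp ℝ 2 P)) ≤ dist f s :=
    Metric.infDist_le_dist_of_mem (hmono hC hC₀)
  have h3 := dist_triangle f (E.l2.starProjection f) s
  have h4 := infDist_l2 E f
  rw [← dist_eq_norm] at h4
  rw [Real.dist_eq, abs_of_nonneg (by linarith)]
  linarith

theorem IsFinite.exists_finite_ae_eq {E : SubSigmaField Ω P} (hE : E.IsFinite) :
    ∃ 𝒮 : Set (Set Ω), 𝒮.Finite ∧ (∀ B ∈ 𝒮, MeasurableSet B) ∧
      ∀ A, MeasurableSet[E.sigma] A → ∃ B ∈ 𝒮, A =ᵐ[P] B := by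
  obtain ⟨C, hC, hgen⟩ := hE
  have : Finite C := hC
  have hCm : ∀ A ∈ C, MeasurableSet[mΩ] A := fun A hA => E.le _ (by
    rw [hgen]; exact MeasurableSpace.measurableSet_generateFrom (Or.inl hA))
  -- The map `φ` records which generators contain a point. Its target is finite, and the sets almost
  -- everywhere equal to some `φ ⁻¹' T` include the generators and the null sets and are closed
  -- under the σ-field operations.
  let φ : Ω → C → Prop := fun ω c => ω ∈ (c : Set Ω)
  have hφ : Measurable φ := measurable_pi_lambda _ fun c => measurableSet_setOfPred.1 (hCm c c.2)
  refine ⟨Set.range fun T : Set (C → Prop) => φ ⁻¹' T, Set.finite_range _, ?_, fun A hA => ?_⟩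
  · rintro _ ⟨T, rfl⟩
    exact hφ T.toFinite.measurableSet
  suffices ∃ T : Set (C → Prop), A =ᵐ[P] φ ⁻¹' T by
    obtain ⟨T, hT⟩ := this
    exact ⟨_, ⟨T, rfl⟩, hT⟩
  rw [hgen] at hA
  induction A, hA using MeasurableSpace.generateFrom_induction with
  | hC A hA _ =>
    rcases hA with hA | hA
    · exact ⟨{g | g ⟨A, hA⟩}, ae_eq_rfl⟩
    · exact ⟨∅, ae_eq_empty.2 hA.2⟩
  | empty => exact ⟨∅, ae_eq_rfl⟩
  | compl A _ ih =>
    obtain ⟨T, hT⟩ := ih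
    exact ⟨Tᶜ, hT.compl⟩
  | iUnion A _ ih =>
    choose T hT using ih
    exact ⟨⋃ n, T n, by rw [Set.preimage_iUnion]; exact Filter.EventuallyEq.countable_iUnion hT⟩

theorem IsFinite.finiteDimensional_l2 [IsFiniteMeasure P] {E : SubSigmaField Ω P}
    (hE : E.IsFinite) : FiniteDimensional ℝ E.l2 := by
  obtain ⟨𝒮, hfin, hmeas, h⟩ := hE.exists_finite_ae_eq
  have : Finite 𝒮 := hfin
  let W : Submodule ℝ (Lp ℝ 2 P) :=
    Submodule.span ℝ (Set.range fun B : 𝒮 => indicatorL2 P (hmeas B B.2))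
  have hWfin : FiniteDimensional ℝ W := FiniteDimensional.span_of_finite ℝ (Set.finite_range _)
  have hle : E.l2 ≤ W := by
    refine l2_le_of_indicator W.closed_of_finiteDimensional fun A hA => ?_
    obtain ⟨B, hB, hAB⟩ := h A hA
    rw [indicatorL2_congr _ (hmeas B hB) hAB]
    exact Submodule.subset_span ⟨⟨B, hB⟩, rfl⟩
  exact Submodule.finiteDimensional_of_le hle

/-- Parseval in `L₂(E)`; the projection can be dropped from the inner products because the basis
vectors lie in `L₂(E)`. -/
theorem norm_sq_starProjection_eq_sum (E : SubSigmaField Ω P) [FiniteDimensional ℝ E.l2]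
    (f : Lp ℝ 2 P) : ‖E.l2.starProjection f‖ ^ 2 =
      ∑ j, ‖inner ℝ f (stdOrthonormalBasis ℝ E.l2 j : Lp ℝ 2 P)‖ ^ 2 := by
  have h := (stdOrthonormalBasis ℝ E.l2).sum_sq_norm_inner_left (E.l2.orthogonalProjectionOnto f)
  rw [Submodule.starProjection_apply, ← Submodule.coe_norm, ← h]
  simp_rw [Submodule.inner_orthogonalProjectionOnto_eq_of_mem_right]

theorem starProjection_indicatorL2 [StandardBorelSpace Ω] [IsFiniteMeasure P]
    (E : SubSigmaField Ω P) {A : Set Ω} (hA : MeasurableSet A) :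
    E.l2.starProjection (indicatorL2 P hA) =ᵐ[P] fun ω => (condExpKernel P E.sigma ω).real A :=
  (((memLp_indicator_const 2 hA (1 : ℝ) (Or.inr (measure_ne_top P A))).condExpL2_ae_eq_condExp
    (𝕜 := ℝ) E.le)).trans (condExpKernel_ae_eq_condExp E.le hA).symm

theorem norm_sq_starProjection_indicatorL2 [StandardBorelSpace Ω] [IsFiniteMeasure P]
    (E : SubSigmaField Ω P) {A : Set Ω} (hA : MeasurableSet A) :
    ‖E.l2.starProjection (indicatorL2 P hA)‖ ^ 2 =
      ∫ ω, (condExpKernel P E.sigma ω).real A ^ 2 ∂P := by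
  rw [← real_inner_self_eq_norm_sq, L2.inner_def]
  refine integral_congr_ae ?_
  filter_upwards [E.starProjection_indicatorL2 hA] with ω hω
  simp only [hω, sq, RCLike.inner_apply, conj_trivial]

theorem integrable_sq_condExpKernel [StandardBorelSpace Ω] [IsFiniteMeasure P]
    (E : SubSigmaField Ω P) {A : Set Ω} (hA : MeasurableSet A) :
    Integrable (fun ω => (condExpKernel P E.sigma ω).real A ^ 2) P := by
  refine Integrable.of_bound (C := 1)
    ((integrable_toReal_condExpKernel hA).aestronglyMeasurable.pow 2) (ae_of_all _ fun ω => ?_)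
  rw [Real.norm_eq_abs, abs_of_nonneg (sq_nonneg _)]
  exact pow_le_one₀ measureReal_nonneg measureReal_le_one

end SubSigmaField

/-! ### Partitions of `(0, 1)` into equal cells -/

/-- The `i`-th cell of the partition of `(0, 1)` into `n + 1` intervals of equal length. -/
def unitCell (n i : ℕ) : Set FavSpace := {x | ⌊((n : ℝ) + 1) * x⌋₊ = i}

theorem measurableSet_unitCell (n i : ℕ) : MeasurableSet (unitCell n i) :=
  (Nat.measurable_floor.comp (measurable_subtype_coe.const_mul _)) (measurableSet_singleton i)

theorem floor_lt_of_unit (n : ℕ) (x : FavSpace) : ⌊((n : ℝ) + 1) * x⌋₊ < n + 1 := by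
  have h0 := x.2.1
  have h1 := x.2.2
  rw [Nat.floor_lt (by positivity)]
  push_cast
  nlinarith [(n.cast_nonneg : (0 : ℝ) ≤ n)]

/-- The cell of index `0` omits the endpoint `0`, so the half-open interval is only an outer bound;
the open interval serves as the inner one, with the same length. -/
theorem image_unitCell_subset (n i : ℕ) :
    Subtype.val '' unitCell n i ⊆ Set.Ico (i / ((n : ℝ) + 1)) ((i + 1) / ((n : ℝ) + 1)) := by
  rintro _ ⟨x, hx, rfl⟩
  have h0 := x.2.1
  have hn : (0 : ℝ) < (n : ℝ) + 1 := by positivity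
  have := (Nat.floor_eq_iff (by positivity)).1 hx
  rw [Set.mem_Ico, div_le_iff₀ hn, lt_div_iff₀ hn]
  constructor <;> nlinarith

theorem subset_image_unitCell {n i : ℕ} (hi : i < n + 1) :
    Set.Ioo (i / ((n : ℝ) + 1)) ((i + 1) / ((n : ℝ) + 1)) ⊆ Subtype.val '' unitCell n i := by
  rintro x ⟨hx1, hx2⟩
  have hn : (0 : ℝ) < (n : ℝ) + 1 := by positivity
  have h0 : 0 < x := lt_of_le_of_lt (by positivity) hx1
  have hi' : (i : ℝ) + 1 ≤ n + 1 := by exact_mod_cast hi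
  have h1 : x < 1 := hx2.trans_le ((div_le_one hn).2 hi')
  rw [div_lt_iff₀ hn] at hx1
  rw [lt_div_iff₀ hn] at hx2
  refine ⟨⟨x, h0, h1⟩, (Nat.floor_eq_iff (by positivity)).2 ⟨?_, ?_⟩, rfl⟩ <;> simp only <;> linarith

theorem favMeasure_unitCell {n i : ℕ} (hi : i < n + 1) :
    favMeasure.real (unitCell n i) = 1 / ((n : ℝ) + 1) := by
  have hlen : ((i : ℝ) + 1) / ((n : ℝ) + 1) - i / ((n : ℝ) + 1) = 1 / ((n : ℝ) + 1) := by ring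
  have h : favMeasure (unitCell n i) = ENNReal.ofReal (1 / ((n : ℝ) + 1)) := by
    rw [favMeasure, comap_subtype_coe_apply measurableSet_Ioo, ← hlen]
    refine le_antisymm ?_ ?_
    · rw [← Real.volume_Ico]
      exact measure_mono (image_unitCell_subset n i)
    · rw [← Real.volume_Ioo]
      exact measure_mono (subset_image_unitCell hi)
  rw [measureReal_def, h, ENNReal.toReal_ofReal (by positivity)]

theorem abs_sub_lt_of_mem_unitCell {n i : ℕ} {x y : FavSpace} (hx : x ∈ unitCell n i)
    (hy : y ∈ unitCell n i) : |(x : ℝ) - y| < 1 / ((n : ℝ) + 1) := by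
  have h1 := image_unitCell_subset n i ⟨x, hx, rfl⟩
  have h2 := image_unitCell_subset n i ⟨y, hy, rfl⟩
  rw [Set.mem_Ico, add_div] at h1 h2
  rw [abs_lt]
  constructor <;> linarith [h1.1, h1.2, h2.1, h2.2]

/-- For a diffuse probability measure, the squares of the masses of the cells of the `n`-th
partition sum to a quantity tending to zero. -/
theorem tendsto_sum_sq_unitCell (ν : Measure FavSpace) [IsProbabilityMeasure ν]
    (hν : ∀ x, ν {x} = 0) :
    Tendsto (fun n => ∑ i ∈ Finset.range (n + 1), ν.real (unitCell n i) ^ 2) atTop (𝓝 0) := by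
  -- `g n x` is the mass of the cell containing `x`, so its `ν`-integral is the sum of the squared
  -- masses.
  let g : ℕ → FavSpace → ℝ := fun n x => ν.real (unitCell n ⌊((n : ℝ) + 1) * x⌋₊)
  have hg : ∀ n, g n = fun x => ∑ i ∈ Finset.range (n + 1),
      (unitCell n i).indicator (fun _ => ν.real (unitCell n i)) x := by
    intro n
    ext x
    rw [Finset.sum_eq_single_of_mem ⌊((n : ℝ) + 1) * x⌋₊
      (Finset.mem_range.2 (floor_lt_of_unit n x))]
    · exact (Set.indicator_of_mem (s := unitCell n _) (by exact rfl) _).symm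
    · intro i _ hi
      exact Set.indicator_of_notMem (s := unitCell n i) (fun h => hi (Eq.symm h)) _
  have hint : ∀ n, ∫ x, g n x ∂ν = ∑ i ∈ Finset.range (n + 1), ν.real (unitCell n i) ^ 2 := by
    intro n
    rw [hg, integral_finsetSum]
    · refine Finset.sum_congr rfl fun i _ => ?_
      rw [integral_indicator_const _ (measurableSet_unitCell n i), smul_eq_mul, sq]
    · intro i _
      exact (integrable_const _).indicator (measurableSet_unitCell n i)
  simp_rw [← hint]
  suffices h : Tendsto (fun n => ∫ x, g n x ∂ν) atTop (𝓝 (∫ _, (0 : ℝ) ∂ν)) by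
    rwa [integral_zero] at h
  refine tendsto_integral_of_dominated_convergence (fun _ => 1) (fun n => ?_)
    (integrable_const _) (fun n => ae_of_all _ fun x => ?_) (ae_of_all _ fun x => ?_)
  · rw [hg]
    exact (Finset.measurable_fun_sum _ fun i _ =>
      measurable_const.indicator (measurableSet_unitCell n i)).aestronglyMeasurable
  · rw [Real.norm_eq_abs, abs_of_nonneg measureReal_nonneg]
    exact measureReal_le_one
  · have := tendsto_measure_of_ae_tendsto_indicator_of_isFiniteMeasure atTop (μ := ν)
      (measurableSet_singleton x)
      (fun n => measurableSet_unitCell n ⌊((n : ℝ) + 1) * x⌋₊) (ae_of_all _ fun y => ?_)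
    · rw [hν] at this
      exact (ENNReal.tendsto_toReal ENNReal.zero_ne_top).comp this
    · by_cases hy : y = x
      · subst hy
        exact Eventually.of_forall fun n => ⟨fun _ => rfl, fun _ => rfl⟩
      · have hpos : 0 < |(y : ℝ) - x| := abs_pos.2 (sub_ne_zero.2 fun h => hy (Subtype.ext h))
        filter_upwards [(tendsto_one_div_add_atTop_nhds_zero_nat (𝕜 := ℝ)).eventually
          (gt_mem_nhds hpos)] with n hn
        refine ⟨fun h => absurd (abs_sub_lt_of_mem_unitCell h rfl) (not_lt.2 hn.le),
          fun h => absurd h hy⟩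

/-! ### Cell energy and conditional nonatomicity -/

namespace SubSigmaField

/-- The sum over the cells `A` of the `n`-th partition of `‖P(A | E)‖²`. -/
noncomputable def cellEnergy (n : ℕ) (E : SSFfav) : ℝ :=
  ∑ i ∈ Finset.range (n + 1),
    ‖E.l2.starProjection (indicatorL2 favMeasure (measurableSet_unitCell n i))‖ ^ 2

theorem continuous_cellEnergy (n : ℕ) : Continuous (cellEnergy n) :=
  continuous_finsetSum _ fun _ _ => continuous_norm_sq_starProjection _

theorem cellEnergy_eq_integral (n : ℕ) (E : SSFfav) : cellEnergy n E =
    ∫ ω, ∑ i ∈ Finset.range (n + 1),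
      (condExpKernel favMeasure E.sigma ω).real (unitCell n i) ^ 2 ∂favMeasure := by
  rw [integral_finsetSum _ fun i _ => E.integrable_sq_condExpKernel (measurableSet_unitCell n i)]
  exact Finset.sum_congr rfl fun i _ => E.norm_sq_starProjection_indicatorL2 _

theorem sum_real_sq_unitCell_le_one (ν : Measure FavSpace) [IsProbabilityMeasure ν] (n : ℕ) :
    ∑ i ∈ Finset.range (n + 1), ν.real (unitCell n i) ^ 2 ≤ 1 := by
  have hdisj : (↑(Finset.range (n + 1)) : Set ℕ).PairwiseDisjoint (unitCell n) :=
    fun i _ j _ hij => Set.disjoint_left.2 fun x hi hj => hij (Eq.trans (Eq.symm hi) hj)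
  calc ∑ i ∈ Finset.range (n + 1), ν.real (unitCell n i) ^ 2
      ≤ ∑ i ∈ Finset.range (n + 1), ν.real (unitCell n i) :=
        Finset.sum_le_sum fun i _ => pow_le_of_le_one measureReal_nonneg measureReal_le_one two_ne_zero
    _ = ν.real (⋃ i ∈ Finset.range (n + 1), unitCell n i) :=
        (measureReal_biUnion_finset hdisj fun i _ => measurableSet_unitCell n i).symm
    _ ≤ 1 := measureReal_le_one

theorem IsCondNonatomic.tendsto_cellEnergy {E : SSFfav} (hE : E.IsCondNonatomic) :
    Tendsto (fun n => cellEnergy n E) atTop (𝓝 0) := by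
  suffices h : Tendsto (fun n => cellEnergy n E) atTop (𝓝 (∫ _, (0 : ℝ) ∂favMeasure)) by
    rwa [integral_zero] at h
  simp_rw [cellEnergy_eq_integral]
  refine tendsto_integral_of_dominated_convergence (fun _ => 1) (fun n => ?_)
    (integrable_const _) (fun n => ae_of_all _ fun ω => ?_) ?_
  · exact (integrable_finsetSum _ fun i _ =>
      E.integrable_sq_condExpKernel (measurableSet_unitCell n i)).aestronglyMeasurable
  · rw [Real.norm_eq_abs, abs_of_nonneg (by positivity)]
    exact sum_real_sq_unitCell_le_one _ n
  · filter_upwards [hE] with ω hω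
    exact tendsto_sum_sq_unitCell _ hω

/-- By Markov's inequality, almost every conditional measure has arbitrarily small sums of squared
cell masses. Each such sum dominates the squared mass of every point, through the cell containing
it, which excludes all points at once. -/
theorem isCondNonatomic_of_cellEnergy {E : SSFfav} (h : ∀ ε > 0, ∃ n, cellEnergy n E < ε) :
    E.IsCondNonatomic := by
  let g : ℕ → FavSpace → ℝ := fun n ω => ∑ i ∈ Finset.range (n + 1),
      (condExpKernel favMeasure E.sigma ω).real (unitCell n i) ^ 2
  have hae : ∀ k : ℕ, ∀ᵐ ω ∂favMeasure, ∃ n, g n ω < 1 / ((k : ℝ) + 1) := by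
    intro k
    have hk : (0 : ℝ) < 1 / ((k : ℝ) + 1) := by positivity
    rw [ae_iff, ← measureReal_eq_zero_iff]
    refine le_antisymm (le_of_forall_pos_lt_add fun ε hε => ?_) measureReal_nonneg
    -- With the energy below threshold times `ε`, Markov's inequality bounds by `ε` the measure of
    -- the set where `g n` reaches the threshold.
    obtain ⟨n, hn⟩ := h (1 / ((k : ℝ) + 1) * ε) (by positivity)
    rw [cellEnergy_eq_integral] at hn
    have h1 := mul_meas_ge_le_integral_of_nonneg (μ := favMeasure) (f := g n)
      (ae_of_all _ fun ω => by positivity) (integrable_finsetSum _ fun i _ =>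
        E.integrable_sq_condExpKernel (measurableSet_unitCell n i)) (1 / ((k : ℝ) + 1))
    have h2 : favMeasure.real {ω | ¬∃ n, g n ω < 1 / ((k : ℝ) + 1)} ≤
        favMeasure.real {ω | 1 / ((k : ℝ) + 1) ≤ g n ω} :=
      measureReal_mono fun ω hω => not_lt.1 (not_exists.1 hω n)
    rw [zero_add]
    refine h2.trans_lt ?_
    exact lt_of_mul_lt_mul_left (h1.trans_lt hn) hk.le
  filter_upwards [ae_all_iff.2 hae] with ω hω x
  set ν := condExpKernel favMeasure E.sigma ω
  have hle : ∀ n, ν.real {x} ^ 2 ≤ g n ω := fun n => by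
    refine le_trans ?_ (Finset.single_le_sum (fun i _ => sq_nonneg (ν.real (unitCell n i)))
      (Finset.mem_range.2 (floor_lt_of_unit n x)))
    exact pow_le_pow_left₀ measureReal_nonneg
      (measureReal_mono (Set.singleton_subset_iff.2 (by exact rfl))) 2
  have hsq : ν.real {x} ^ 2 ≤ 0 :=
    ge_of_tendsto' (tendsto_one_div_add_atTop_nhds_zero_nat (𝕜 := ℝ)) fun k => by
      obtain ⟨n, hn⟩ := hω k
      exact (hle n).trans hn.le
  rw [← measureReal_eq_zero_iff]
  exact pow_eq_zero_iff two_ne_zero |>.1 (le_antisymm hsq (sq_nonneg _))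

theorem orthonormal_unitCell (n : ℕ) : Orthonormal ℝ fun i : Fin (n + 1) =>
    √((n : ℝ) + 1) • indicatorL2 favMeasure (measurableSet_unitCell n i) := by
  have hn : (0 : ℝ) < (n : ℝ) + 1 := by positivity
  rw [orthonormal_iff_ite]
  intro i j
  have hinner : inner ℝ (indicatorL2 favMeasure (measurableSet_unitCell n i))
      (indicatorL2 favMeasure (measurableSet_unitCell n j)) =
      favMeasure.real (unitCell n i ∩ unitCell n j) := by
    rw [indicatorL2, L2.inner_indicatorConstLp_eq_inner_setIntegral, integral_congr_ae
      (ae_restrict_of_ae (coeFn_indicatorL2 (measurableSet_unitCell n j))),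
      setIntegral_indicator (measurableSet_unitCell n j)]
    simp
  rw [real_inner_smul_left, real_inner_smul_right, ← mul_assoc, Real.mul_self_sqrt hn.le, hinner]
  split_ifs with h
  · subst h
    rw [Set.inter_self, favMeasure_unitCell i.2]
    field_simp
  · have : unitCell n i ∩ unitCell n j = ∅ := by
      ext x
      refine ⟨fun ⟨hi, hj⟩ => h (Fin.ext (Eq.trans (Eq.symm hi) hj)), fun h => h.elim⟩
    simp [this]

/-- A trace estimate: after rescaling by `n + 1`, the energy is a double sum over the orthonormal
cell indicators and a basis of `L₂(E)`, and Bessel's inequality bounds by `1` the contribution of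
each basis vector. -/
theorem cellEnergy_le (n : ℕ) (E : SSFfav) [FiniteDimensional ℝ E.l2] :
    cellEnergy n E ≤ Module.finrank ℝ E.l2 / ((n : ℝ) + 1) := by
  have hn : (0 : ℝ) < (n : ℝ) + 1 := by positivity
  rw [le_div_iff₀ hn, cellEnergy, Finset.sum_range]
  simp_rw [norm_sq_starProjection_eq_sum]
  rw [Finset.sum_comm, Finset.sum_mul]
  have hj : ∀ j, (∑ i : Fin (n + 1), ‖inner ℝ (indicatorL2 favMeasure (measurableSet_unitCell n i))
      (stdOrthonormalBasis ℝ E.l2 j : Lp ℝ 2 favMeasure)‖ ^ 2) * ((n : ℝ) + 1) ≤ 1 := by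
    intro j
    have h := (orthonormal_unitCell n).sum_inner_products_le
      (stdOrthonormalBasis ℝ E.l2 j : Lp ℝ 2 favMeasure) (s := Finset.univ)
    rw [← Submodule.coe_norm, (stdOrthonormalBasis ℝ E.l2).norm_eq_one, one_pow] at h
    refine le_trans (le_of_eq ?_) h
    rw [Finset.sum_mul]
    refine Finset.sum_congr rfl fun i _ => ?_
    rw [real_inner_smul_left, norm_mul, mul_pow, Real.norm_eq_abs √_, sq_abs, Real.sq_sqrt hn.le,
      mul_comm]
  refine (Finset.sum_le_sum fun j _ => hj j).trans ?_
  simp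

theorem IsFinite.isCondNonatomic {E : SSFfav} (hE : E.IsFinite) : E.IsCondNonatomic := by
  have := hE.finiteDimensional_l2
  have h : Tendsto (fun n : ℕ => (Module.finrank ℝ E.l2 : ℝ) / ((n : ℝ) + 1)) atTop (𝓝 0) := by
    simpa [div_eq_mul_inv] using
      (tendsto_one_div_add_atTop_nhds_zero_nat (𝕜 := ℝ)).const_mul (Module.finrank ℝ E.l2 : ℝ)
  refine isCondNonatomic_of_cellEnergy fun ε hε => ?_
  obtain ⟨n, hn⟩ := (h.eventually (gt_mem_nhds hε)).exists
  exact ⟨n, (cellEnergy_le n E).trans_lt hn⟩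

end SubSigmaField

/-! ### The Gδ property and the conclusion -/

open SubSigmaField in
theorem isGδ_condNonatomicSet : IsGδ condNonatomicSet := by
  have h : condNonatomicSet = ⋂ k : ℕ, ⋃ n, {E | cellEnergy n E < 1 / ((k : ℝ) + 1)} := by
    ext E
    simp only [Set.mem_iInter, Set.mem_iUnion]
    refine ⟨fun hE k => ?_, fun hE => isCondNonatomic_of_cellEnergy fun ε hε => ?_⟩
    · exact ((IsCondNonatomic.tendsto_cellEnergy hE).eventually
        (gt_mem_nhds (by positivity : (0 : ℝ) < 1 / ((k : ℝ) + 1)))).exists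
    · obtain ⟨k, hk⟩ := exists_nat_one_div_lt hε
      obtain ⟨n, hn⟩ := hE k
      exact ⟨n, lt_trans hn hk⟩
  rw [h]
  exact IsGδ.iInter_of_isOpen fun k => isOpen_iUnion fun n =>
    isOpen_lt (continuous_cellEnergy n) continuous_const

theorem lemma3p7 :
    PolishSpace SSFfav ∧
    IsGδ condNonatomicSet ∧
    {E : SSFfav | E.IsFinite} ⊆ condNonatomicSet ∧
    Dense {E : SSFfav | E.IsFinite} ∧
    Dense condNonatomicSet ∧
    condNonatomicSet ∈ residual SSFfav := by
  have hsub : {E : SSFfav | E.IsFinite} ⊆ condNonatomicSet := fun _ hE =>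
    SubSigmaField.IsFinite.isCondNonatomic hE
  have hdense : Dense condNonatomicSet := SubSigmaField.dense_isFinite.mono hsub
  -- The exponent being finite gives second countability of `L₂`, which the `polishSpace` instance
  -- requires.
  have : Fact ((2 : ℝ≥0∞) ≠ ∞) := ⟨by simp⟩
  exact ⟨inferInstance, isGδ_condNonatomicSet, hsub, SubSigmaField.dense_isFinite, hdense,
    residual_of_dense_Gδ isGδ_condNonatomicSet hdense⟩
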